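/- Let $\Gamma$ be a compact metric graph: a finite graph with at least one edge (loops and multiple edges allowed) in which every edge $e$ is identified with an interval $[0,l_e]$, $0<l_e<\infty$. Let $-\Delta$ be any self-adjoint realisation of the Laplacian on $\Gamma$, i.e. any self-adjoint operator in $L^2(\Gamma)=\bigoplus_e L^2(0,l_e)$ that extends the operator $(f_e)_e\mapsto(-f_e'')_e$ with domain $\bigoplus_e H^2_0(0,l_e)$, where $H^2_0(0,l)$ consists of the functions in $H^2(0,l)$ that vanish together with their first derivatives at both end points. Then all eigenvalues of $-\Delta$ are real and of finite multiplicity, for every $K\ge 0$ the number $N(K)$ of eigenvalues $\mu\le K^2$, counted with multiplicities, is finite, and $$N(K)\sim\frac{\mathcal L}{\pi}\,K,\qquad K\to\infty,$$ where $\mathcal L=\sum_e l_e$ is the total length of the graph. In particular, $-\Delta$ has infinitely many eigenvalues, and they accumulate only at $+\infty$. -/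

import Mathlib

open MeasureTheory Set Filter Asymptotics
open scoped ENNReal

namespace QuantumGraph

/-- A finite (compact) metric graph with vertex set `V` and edge set `E`: every edge `e` joins its
initial vertex to its terminal vertex and carries a coordinate in `[0, len e]`, where
`0 < len e < ∞`. Loops and multiple edges are allowed. -/
structure MetricGraph (V E : Type*) [Fintype V] [Fintype E] where
  /-- the initial vertex of an edge (coordinate `0`) -/
  initial : E → V
  /-- the terminal vertex of an edge (coordinate `len e`) -/
  terminal : E → V
  /-- the length of an edge -/
  len : E → ℝ
  len_pos : ∀ e, 0 < len e

/-- The Hilbert space `L²(0, l)` of complex valued functions. -/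
abbrev L2Interval (l : ℝ) : Type := Lp ℂ 2 (volume.restrict (Ioo 0 l))

/-- `g` is the weak derivative of `f` on the interval `(0, l)`:
`∫ φ' f = - ∫ φ g` for every test function `φ ∈ C_c^∞(0, l)`. -/
def HasWeakDeriv {l : ℝ} (f g : L2Interval l) : Prop :=
  ∀ φ : ℝ → ℝ, ContDiff ℝ (⊤ : ℕ∞) φ → HasCompactSupport φ → tsupport φ ⊆ Ioo 0 l →
    ∫ x in Ioo 0 l, deriv φ x • f x = - ∫ x in Ioo 0 l, φ x • g x

/-- `f` has a representative that is continuous on `[0, l]` and vanishes at both end points. -/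
def VanishesAtEnds {l : ℝ} (f : L2Interval l) : Prop :=
  ∃ u : ℝ → ℂ, ContinuousOn u (Icc 0 l) ∧ (∀ᵐ x ∂volume.restrict (Ioo 0 l), f x = u x) ∧
    u 0 = 0 ∧ u l = 0

/-- `f` belongs to the Sobolev space `H²_0(0, l)` and has second (weak) derivative `f₂ ∈ L²(0, l)`:
the weak derivatives `f'` and `f'' = f₂` lie in `L²(0, l)`, and `f` and `f'` vanish at both
ends of the interval. -/
def IsH2ZeroWith {l : ℝ} (f f₂ : L2Interval l) : Prop :=
  ∃ f₁ : L2Interval l, HasWeakDeriv f f₁ ∧ HasWeakDeriv f₁ f₂ ∧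
    VanishesAtEnds f ∧ VanishesAtEnds f₁

section WeakDerivLemmas

variable {l : ℝ}

theorem integrable_smul_L2 (f : L2Interval l) {ψ : ℝ → ℝ} (hψ : Continuous ψ)
    (hc : HasCompactSupport ψ) :
    Integrable (fun x => ψ x • f x) (volume.restrict (Ioo 0 l)) := by
  have hf : Integrable f (volume.restrict (Ioo 0 l)) := (Lp.memLp f).integrable (by norm_num)
  obtain ⟨C, hC⟩ := hc.exists_bound_of_continuous hψ
  exact hf.bdd_smul C hψ.aestronglyMeasurable (Eventually.of_forall hC)

theorem HasWeakDeriv.zero : HasWeakDeriv (0 : L2Interval l) 0 := by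
  intro φ _ _ _
  have h : ((0 : L2Interval l) : ℝ → ℂ) =ᵐ[volume.restrict (Ioo 0 l)] 0 := Lp.coeFn_zero _ _ _
  have h1 : ∀ ψ : ℝ → ℝ, ∫ x in Ioo 0 l, ψ x • (0 : L2Interval l) x = 0 := by
    intro ψ
    rw [integral_congr_ae (g := fun _ => (0 : ℂ))]
    · simp
    · filter_upwards [h] with x hx
      rw [hx, Pi.zero_apply, smul_zero]
  rw [h1, h1, neg_zero]

theorem HasWeakDeriv.add {f g f' g' : L2Interval l} (hf : HasWeakDeriv f f')
    (hg : HasWeakDeriv g g') : HasWeakDeriv (f + g) (f' + g') := by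
  intro φ h1 h2 h3
  have key : ∀ (ψ : ℝ → ℝ) (a b : L2Interval l), Continuous ψ → HasCompactSupport ψ →
      ∫ x in Ioo 0 l, ψ x • (a + b : L2Interval l) x =
        (∫ x in Ioo 0 l, ψ x • a x) + ∫ x in Ioo 0 l, ψ x • b x := by
    intro ψ a b hψ hc
    rw [← integral_add (integrable_smul_L2 a hψ hc) (integrable_smul_L2 b hψ hc)]
    refine integral_congr_ae ?_
    filter_upwards [Lp.coeFn_add a b] with x hx
    rw [hx, Pi.add_apply, smul_add]
  rw [key _ _ _ (h1.continuous_deriv (by simp)) h2.deriv, key _ _ _ h1.continuous h2,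
    hf φ h1 h2 h3, hg φ h1 h2 h3]
  ring

theorem HasWeakDeriv.smul {f f' : L2Interval l} (c : ℂ) (hf : HasWeakDeriv f f') :
    HasWeakDeriv (c • f) (c • f') := by
  intro φ h1 h2 h3
  have key : ∀ (ψ : ℝ → ℝ) (a : L2Interval l),
      ∫ x in Ioo 0 l, ψ x • (c • a : L2Interval l) x = c * ∫ x in Ioo 0 l, ψ x • a x := by
    intro ψ a
    rw [← integral_const_mul]
    refine integral_congr_ae ?_
    filter_upwards [Lp.coeFn_smul c a] with x hx
    rw [hx, Pi.smul_apply, smul_eq_mul, mul_smul_comm]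
  rw [key, key, hf φ h1 h2 h3, mul_neg]

/-- Weak derivatives are unique. -/
theorem HasWeakDeriv.unique {f g h : L2Interval l} (hg : HasWeakDeriv f g)
    (hh : HasWeakDeriv f h) : g = h := by
  have hloc : ∀ a : L2Interval l, LocallyIntegrableOn a (Ioo 0 l) volume := fun a =>
    IntegrableOn.locallyIntegrableOn ((Lp.memLp a).integrable (by norm_num))
  have key := isOpen_Ioo.ae_eq_zero_of_integral_contDiff_smul_eq_zero (μ := volume)
    ((hloc g).sub (hloc h)) (by
      intro φ h1 h2 h3
      have e1 := hg φ h1 h2 h3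
      rw [hh φ h1 h2 h3, neg_inj] at e1
      have hs : ∀ a : ℝ → ℂ, ∫ x, φ x • a x = ∫ x in Ioo 0 l, φ x • a x := by
        intro a
        refine (setIntegral_eq_integral_of_forall_compl_eq_zero ?_).symm
        intro x hx
        rw [image_eq_zero_of_notMem_tsupport (fun hx' => hx (h3 hx')), zero_smul]
      rw [hs]
      simp only [Pi.sub_apply, smul_sub]
      rw [integral_sub (integrable_smul_L2 g h1.continuous h2)
        (integrable_smul_L2 h h1.continuous h2), e1, sub_self])
  apply Lp.ext
  rw [Filter.EventuallyEq, ae_restrict_iff' measurableSet_Ioo]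
  filter_upwards [key] with x hx hxm
  exact sub_eq_zero.mp (hx hxm)

theorem VanishesAtEnds.zero : VanishesAtEnds (0 : L2Interval l) :=
  ⟨fun _ => 0, continuousOn_const, by
    filter_upwards [Lp.coeFn_zero ℂ 2 (volume.restrict (Ioo 0 l))] with x hx
    simpa using hx, rfl, rfl⟩

theorem VanishesAtEnds.add {f g : L2Interval l} (hf : VanishesAtEnds f) (hg : VanishesAtEnds g) :
    VanishesAtEnds (f + g) := by
  obtain ⟨u, hu, hfu, hu0, hul⟩ := hf
  obtain ⟨v, hv, hgv, hv0, hvl⟩ := hg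
  refine ⟨fun x => u x + v x, hu.add hv, ?_, by simp [hu0, hv0], by simp [hul, hvl]⟩
  filter_upwards [hfu, hgv, Lp.coeFn_add f g] with x h1 h2 h3
  rw [h3, Pi.add_apply, h1, h2]

theorem VanishesAtEnds.smul {f : L2Interval l} (c : ℂ) (hf : VanishesAtEnds f) :
    VanishesAtEnds (c • f) := by
  obtain ⟨u, hu, hfu, hu0, hul⟩ := hf
  refine ⟨fun x => c * u x, continuousOn_const.mul hu, ?_, by simp [hu0], by simp [hul]⟩
  filter_upwards [hfu, Lp.coeFn_smul c f] with x h1 h2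
  rw [h2, Pi.smul_apply, h1, smul_eq_mul]

theorem IsH2ZeroWith.zero : IsH2ZeroWith (0 : L2Interval l) 0 :=
  ⟨0, .zero, .zero, .zero, .zero⟩

theorem IsH2ZeroWith.add {f g f₂ g₂ : L2Interval l} (hf : IsH2ZeroWith f f₂)
    (hg : IsH2ZeroWith g g₂) : IsH2ZeroWith (f + g) (f₂ + g₂) := by
  obtain ⟨f₁, a, b, c, d⟩ := hf
  obtain ⟨g₁, a', b', c', d'⟩ := hg
  exact ⟨f₁ + g₁, a.add a', b.add b', c.add c', d.add d'⟩

theorem IsH2ZeroWith.smul {f f₂ : L2Interval l} (c : ℂ) (hf : IsH2ZeroWith f f₂) :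
    IsH2ZeroWith (c • f) (c • f₂) := by
  obtain ⟨f₁, a, b, u, v⟩ := hf
  exact ⟨c • f₁, a.smul c, b.smul c, u.smul c, v.smul c⟩

theorem IsH2ZeroWith.unique {f g h : L2Interval l} (hg : IsH2ZeroWith f g)
    (hh : IsH2ZeroWith f h) : g = h := by
  obtain ⟨g₁, a, b, -, -⟩ := hg
  obtain ⟨h₁, a', b', -, -⟩ := hh
  obtain rfl := a.unique a'
  exact b.unique b'

end WeakDerivLemmas

namespace MetricGraph

variable {V E : Type*} [Fintype V] [Fintype E]

/-- The total length of a metric graph. -/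
def totalLength (Γ : MetricGraph V E) : ℝ := ∑ e, Γ.len e

/-- The quantum graph Hilbert space `L²(Γ) = ⨁ₑ L²(0, len e)` (orthogonal sum), with scalar
product `⟪F, G⟫ = ∑ₑ ∫ conj (fₑ) gₑ`. -/
abbrev L2 (Γ : MetricGraph V E) : Type _ := PiLp 2 (fun e : E => L2Interval (Γ.len e))

/-- The graph of the operator `F ↦ -F'' = (-fₑ'')ₑ` with domain `⨁ₑ H²_0(0, len e)`. -/
def minimalLaplacianGraph (Γ : MetricGraph V E) : Submodule ℂ (Γ.L2 × Γ.L2) where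
  carrier := {p | ∀ e, IsH2ZeroWith (p.1 e) (-(p.2 e))}
  zero_mem' := fun e => by simpa using IsH2ZeroWith.zero
  add_mem' := fun {p q} hp hq e => by
    have h := (hp e).add (hq e)
    rw [← neg_add] at h
    exact h
  smul_mem' := fun c p hp e => by
    have h := (hp e).smul c
    rw [smul_neg] at h
    exact h

/-- The minimal operator: the negative Laplacian `F ↦ -F''` with domain `⨁ₑ H²_0(0, len e)`, as a
partially defined operator in `L²(Γ)`. -/
noncomputable def minimalLaplacian (Γ : MetricGraph V E) : Γ.L2 →ₗ.[ℂ] Γ.L2 :=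
  Γ.minimalLaplacianGraph.toLinearPMap

theorem graph_minimalLaplacian (Γ : MetricGraph V E) :
    Γ.minimalLaplacian.graph = Γ.minimalLaplacianGraph := by
  apply Submodule.toLinearPMap_graph_eq
  intro p hp h0
  have hz : ∀ e, p.2 e = 0 := fun e => by
    have h := hp e
    rw [h0] at h
    simpa using h.unique IsH2ZeroWith.zero
  exact PiLp.ext hz

/-- A self-adjoint realisation of the (negative) Laplacian on a metric graph: a self-adjoint
operator in `L²(Γ)` that extends the minimal operator. -/
def IsSelfAdjointLaplacian (Γ : MetricGraph V E) (T : Γ.L2 →ₗ.[ℂ] Γ.L2) : Prop :=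
  Γ.minimalLaplacian ≤ T ∧ IsSelfAdjoint T

end MetricGraph

section Eigenvalues

variable {H : Type*} [NormedAddCommGroup H] [InnerProductSpace ℂ H]

/-- The eigenspace `{F ∈ dom T | T F = μ F}` of an unbounded operator `T`. -/
def eigenspace (T : H →ₗ.[ℂ] H) (μ : ℂ) : Submodule ℂ H where
  carrier := {F | ∃ h : F ∈ T.domain, T ⟨F, h⟩ = μ • F}
  zero_mem' := ⟨T.domain.zero_mem, by rw [smul_zero]; exact T.map_zero⟩
  add_mem' := by
    rintro F G ⟨hF, hF'⟩ ⟨hG, hG'⟩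
    refine ⟨T.domain.add_mem hF hG, ?_⟩
    rw [smul_add, ← hF', ← hG']
    exact T.map_add ⟨F, hF⟩ ⟨G, hG⟩
  smul_mem' := by
    rintro c F ⟨hF, hF'⟩
    refine ⟨T.domain.smul_mem c hF, ?_⟩
    rw [smul_comm, ← hF']
    exact T.map_smul c ⟨F, hF⟩

/-- `μ` is an eigenvalue of the unbounded operator `T`. -/
def IsEigenvalue (T : H →ₗ.[ℂ] H) (μ : ℂ) : Prop := eigenspace T μ ≠ ⊥

/-- The eigenvalue counting function `N(K)`: the number of real eigenvalues `μ ≤ K²`, each counted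
with its multiplicity `dim (eigenspace T μ)`. (A genuine count whenever there are only finitely
many such eigenvalues, all of finite multiplicity.) -/
noncomputable def eigenvalueCount (T : H →ₗ.[ℂ] H) (K : ℝ) : ℕ :=
  ∑ᶠ (μ : ℝ) (_ : μ ≤ K ^ 2), Module.finrank ℂ (eigenspace T (μ : ℂ))

end Eigenvalues

end QuantumGraph

/-! Every self-adjoint realisation differs from the decoupled periodic Laplacian by a finite rank
error, and the periodic spectrum is explicit. Let `G` be diagonal in the edgewise exponentials, with
the inverse periodic eigenvalues on its diagonal (and 1 for the zero mode). If `g` is orthogonal to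
the space `M` of edgewise quadratics, then `G g` lies in H²_0 on each edge and `-(G g)'' = g`
(`exists_isH2ZeroWith`), so `T (G g) = g` for every extension `T`. Self-adjointness turns this into
`f - G (T f) ∈ M` for all `f` in the domain (`sub_mem`).

The two counting functions then differ by at most `dim M`, by comparing quadratic forms on
subspaces. For the upper bound, the span of low eigenvectors of `T` maps injectively to low modes
plus `M` (`finrank_le`). The lower bound (`le_eigenvalueCount`) exchanges the roles and needs an
eigenbasis of `T`, which comes from a compact resolvent (`exists_resolvent`). Counting integers in
an interval for each edge gives Weyl's law with bounded remainder. -/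

namespace QuantumGraph

/-! ### Diagonal operators in a Hilbert basis and their quadratic forms. -/

section Hilbert

variable {H : Type*} [NormedAddCommGroup H] [InnerProductSpace ℂ H]

theorem isCompactOperator_of_forall_mem {M : Submodule ℂ H} [FiniteDimensional ℂ M]
    (L : H →L[ℂ] H) (h : ∀ x, L x ∈ M) : IsCompactOperator L := by
  have : ProperSpace M := FiniteDimensional.proper ℂ M
  exact (isCompactOperator_of_locallyCompactSpace_rng M.subtypeL).comp_clm (L.codRestrict M h)

section Basis

variable {ι : Type*} (b : HilbertBasis ι ℂ H)

theorem hilbertBasis_ext {x y : H} (h : ∀ i, inner ℂ (b i) x = inner ℂ (b i) y) : x = y := by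
  apply b.repr.injective
  apply lp.ext
  funext i
  rw [b.repr_apply_apply, b.repr_apply_apply, h i]

/-- A bounded real sequence defines a bounded diagonal operator. -/
theorem exists_diagonal {ν : ι → ℝ} {C : ℝ} (hC : 0 ≤ C) (hν : ∀ i, |ν i| ≤ C) :
    ∃ D : H →L[ℂ] H, (∀ x i, inner ℂ (b i) (D x) = ν i * inner ℂ (b i) x) ∧ ‖D‖ ≤ C := by
  have hle : ∀ x i, ‖(ν i : ℂ) * b.repr x i‖ ≤ ‖((C : ℂ) • b.repr x) i‖ := by
    intro x i
    rw [lp.coeFn_smul, Pi.smul_apply, smul_eq_mul, norm_mul, norm_mul, Complex.norm_real,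
      Complex.norm_real, Real.norm_eq_abs, Real.norm_eq_abs, abs_of_nonneg hC]
    gcongr
    exact hν i
  have hmem : ∀ x, Memℓp (fun i => (ν i : ℂ) * b.repr x i) 2 := fun x =>
    (lp.memℓp ((C : ℂ) • b.repr x)).mono' (hle x)
  let D : H →ₗ[ℂ] H :=
    { toFun := fun x => b.repr.symm ⟨_, hmem x⟩
      map_add' := fun x y => by
        rw [← map_add]
        congr 1
        apply lp.ext
        funext i
        simp only [map_add, lp.coeFn_add, Pi.add_apply, mul_add]
      map_smul' := fun c x => by
        rw [RingHom.id_apply, ← map_smul]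
        congr 1
        apply lp.ext
        funext i
        simp [mul_left_comm] }
  have hD : ∀ x, ‖D x‖ ≤ C * ‖x‖ := by
    intro x
    change ‖b.repr.symm ⟨_, hmem x⟩‖ ≤ _
    rw [LinearIsometryEquiv.norm_map]
    refine (lp.norm_mono (by norm_num) (hle x)).trans ?_
    rw [norm_smul, LinearIsometryEquiv.norm_map, Complex.norm_real, Real.norm_eq_abs,
      abs_of_nonneg hC]
  refine ⟨D.mkContinuous C hD, fun x i => ?_, LinearMap.mkContinuous_norm_le _ hC _⟩
  rw [LinearMap.mkContinuous_apply, ← b.repr_apply_apply, ← b.repr_apply_apply]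
  change b.repr (b.repr.symm ⟨_, hmem x⟩) i = _
  rw [LinearIsometryEquiv.apply_symm_apply]

/-- Only finitely many entries have modulus at least `1 / (n + 1)`; subtracting the diagonal
operator `F'` of the smaller ones leaves finite rank, at distance at most `1 / (n + 1)` from `G`. -/
theorem isCompactOperator_diagonal [CompleteSpace H] {ν : ι → ℝ} (hν : Tendsto ν cofinite (nhds 0))
    {G : H →L[ℂ] H} (hG : ∀ x i, inner ℂ (b i) (G x) = ν i * inner ℂ (b i) x) :
    IsCompactOperator G := by
  classical
  have happ : ∀ n : ℕ, ∃ F : H →L[ℂ] H, IsCompactOperator F ∧ ‖G - F‖ ≤ 1 / ((n : ℝ) + 1) := by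
    intro n
    have hpos : (0 : ℝ) < 1 / ((n : ℝ) + 1) := by positivity
    have hfin : {i | ¬ |ν i| < 1 / ((n : ℝ) + 1)}.Finite := by
      have := hν.eventually (Metric.ball_mem_nhds 0 hpos)
      simpa [Filter.eventually_cofinite, Metric.mem_ball, Real.dist_eq] using this
    obtain ⟨F', hF', hn⟩ := exists_diagonal b
      (ν := fun i => if |ν i| < 1 / ((n : ℝ) + 1) then ν i else 0)
      hpos.le (fun i => by
        split_ifs with h
        · exact h.le
        · simpa using hpos.le)
    refine ⟨G - F', ?_, by simpa using hn⟩
    have : FiniteDimensional ℂ (Submodule.span ℂ (b '' {i | ¬ |ν i| < 1 / ((n : ℝ) + 1)})) :=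
      FiniteDimensional.span_of_finite ℂ (hfin.image b)
    apply isCompactOperator_of_forall_mem
      (M := Submodule.span ℂ (b '' {i | ¬ |ν i| < 1 / ((n : ℝ) + 1)}))
    intro x
    have hx : (G - F') x = ∑ i ∈ hfin.toFinset, (ν i * inner ℂ (b i) x : ℂ) • b i := by
      apply hilbertBasis_ext b
      intro j
      rw [sub_apply, inner_sub_right, hG, hF', inner_sum]
      simp only [inner_smul_right, orthonormal_iff_ite.mp b.orthonormal, mul_ite, mul_one, mul_zero,
        Finset.sum_ite_eq, Finite.mem_toFinset]
      by_cases h : |ν j| < 1 / ((n : ℝ) + 1)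
      · simp only [mem_ofPred_eq, h]; simp
      · simp only [mem_ofPred_eq, h]; simp
    rw [hx]
    refine Submodule.sum_mem _ fun i hi => Submodule.smul_mem _ _ (Submodule.subset_span ⟨i, ?_, rfl⟩)
    simpa using hi
  choose F hF hn using happ
  refine isCompactOperator_of_tendsto (l := atTop) (F := F) ?_ (Eventually.of_forall hF)
  rw [tendsto_iff_norm_sub_tendsto_zero]
  refine squeeze_zero (fun _ => norm_nonneg _) (fun n => ?_) tendsto_one_div_add_atTop_nhds_zero_nat
  rw [norm_sub_rev]
  exact hn n

/-- The quadratic form of a diagonal relation. -/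
theorem hasSum_re_inner_of_coeff {m : ι → ℝ} {f h : H}
    (hh : ∀ i, inner ℂ (b i) h = m i * inner ℂ (b i) f) :
    HasSum (fun i => m i * ‖inner ℂ (b i) f‖ ^ 2) (inner ℂ h f).re := by
  have key : ∀ i, inner ℂ h (b i) * inner ℂ (b i) f = ((m i * ‖inner ℂ (b i) f‖ ^ 2 : ℝ) : ℂ) := by
    intro i
    rw [← inner_conj_symm h, hh, map_mul, Complex.conj_ofReal, mul_assoc,
      ← Complex.normSq_eq_conj_mul_self, Complex.normSq_eq_norm_sq]
    push_cast
    ring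
  have := Complex.hasSum_re (b.hasSum_inner_mul_inner h f)
  simpa only [key, Complex.ofReal_re] using this

theorem hasSum_mul_norm_sq (c : ℝ) (f : H) :
    HasSum (fun i => c * ‖inner ℂ (b i) f‖ ^ 2) (c * ‖f‖ ^ 2) := by
  have := hasSum_re_inner_of_coeff b (m := fun _ => 1) (f := f) (h := f) (fun i => by simp)
  simp only [one_mul, show (inner ℂ f f).re = ‖f‖ ^ 2 from inner_self_eq_norm_sq (𝕜 := ℂ) f] at this
  exact this.mul_left c

/-- The multipliers `m` may be unbounded. The bound is asked only where `f` has a nonzero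
coefficient, so spectral localisation of `f` is expressed by vanishing coefficients. -/
theorem re_inner_le_of_coeff {m : ι → ℝ} {c : ℝ} {f h : H}
    (hh : ∀ i, inner ℂ (b i) h = m i * inner ℂ (b i) f)
    (hm : ∀ i, inner ℂ (b i) f ≠ 0 → m i ≤ c) : (inner ℂ h f).re ≤ c * ‖f‖ ^ 2 := by
  refine hasSum_le (fun j => ?_) (hasSum_re_inner_of_coeff b hh) (hasSum_mul_norm_sq b c f)
  by_cases hj : inner ℂ (b j) f = 0
  · simp [hj]
  · exact mul_le_mul_of_nonneg_right (hm j hj) (by positivity)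

/-- If `h` arises from `f ≠ 0` by multiplying coefficients with numbers `> c`, then
`⟪h, f⟫ > c ‖f‖²`. -/
theorem lt_re_inner_of_coeff {m : ι → ℝ} {c : ℝ} {f h : H} (hf : f ≠ 0)
    (hh : ∀ i, inner ℂ (b i) h = m i * inner ℂ (b i) f)
    (hm : ∀ i, inner ℂ (b i) f ≠ 0 → c < m i) :
    c * ‖f‖ ^ 2 < (inner ℂ h f).re := by
  obtain ⟨i, hi⟩ : ∃ i, inner ℂ (b i) f ≠ 0 := by
    by_contra! hall
    exact hf (hilbertBasis_ext b fun i => by rw [hall i, inner_zero_right])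
  refine hasSum_lt (i := i) (fun j => ?_) ?_ (hasSum_mul_norm_sq b c f)
    (hasSum_re_inner_of_coeff b hh)
  · by_cases hj : inner ℂ (b j) f = 0
    · simp [hj]
    · exact mul_le_mul_of_nonneg_right (hm j hj).le (by positivity)
  · exact mul_lt_mul_of_pos_right (hm i hi) (by positivity)

end Basis

end Hilbert

end QuantumGraph

namespace QuantumGraph

/-! ### Self-adjoint operators, the comparison structure, and the upper bound. -/

section SelfAdjoint

variable {H : Type*} [NormedAddCommGroup H] [InnerProductSpace ℂ H]
  {T : H →ₗ.[ℂ] H}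

theorem mem_eigenspace_iff {μ : ℂ} {f : H} : f ∈ eigenspace T μ ↔ (f, μ • f) ∈ T.graph := by
  rw [LinearPMap.mem_graph_iff]
  constructor
  · rintro ⟨h, h'⟩
    exact ⟨⟨f, h⟩, rfl, h'⟩
  · rintro ⟨⟨y, hy⟩, rfl, h⟩
    exact ⟨hy, h⟩

variable [CompleteSpace H]

theorem graph_symm (hT : IsSelfAdjoint T) {f g f' g' : H} (h : (f, g) ∈ T.graph)
    (h' : (f', g') ∈ T.graph) : inner ℂ g f' = inner ℂ f g' := by
  have key := LinearPMap.adjoint_isFormalAdjoint hT.dense_domain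
  rw [LinearPMap.isSelfAdjoint_def.mp hT] at key
  obtain ⟨y, rfl, rfl⟩ := (LinearPMap.mem_graph_iff T).mp h
  obtain ⟨y', rfl, rfl⟩ := (LinearPMap.mem_graph_iff T).mp h'
  exact key y y'

/-- The maximality half of self-adjointness: the adjoint is contained in `T`. -/
theorem mem_graph_of_symm (hT : IsSelfAdjoint T) {f g : H}
    (h : ∀ f' g', (f', g') ∈ T.graph → inner ℂ g f' = inner ℂ f g') : (f, g) ∈ T.graph := by
  have hx : ∀ x : T.domain, inner ℂ g (x : H) = inner ℂ f (T x) := fun x => h _ _ (T.mem_graph x)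
  have hd := LinearPMap.mem_adjoint_domain_of_exists (T := T) f ⟨g, hx⟩
  have he := LinearPMap.adjoint_apply_eq hT.dense_domain ⟨f, hd⟩ hx
  have h2 := T.adjoint.mem_graph ⟨f, hd⟩
  rw [he] at h2
  have : (f, g) ∈ T.adjoint.graph := h2
  rwa [LinearPMap.isSelfAdjoint_def.mp hT] at this

theorem eigenvalue_im (hT : IsSelfAdjoint T) {μ : ℂ} {f : H} (hf : f ∈ eigenspace T μ)
    (h0 : f ≠ 0) : μ.im = 0 := by
  rw [mem_eigenspace_iff] at hf
  have := graph_symm hT hf hf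
  rw [inner_smul_left, inner_smul_right] at this
  have h2 := mul_right_cancel₀ (inner_self_ne_zero.mpr h0) this
  exact Complex.conj_eq_iff_im.mp h2

theorem eigenspace_orthogonal (hT : IsSelfAdjoint T) {μ μ' : ℝ} (hne : μ ≠ μ') {f f' : H}
    (hf : f ∈ eigenspace T (μ : ℂ)) (hf' : f' ∈ eigenspace T (μ' : ℂ)) : inner ℂ f f' = 0 := by
  rw [mem_eigenspace_iff] at hf hf'
  have := graph_symm hT hf hf'
  rw [inner_smul_left, inner_smul_right, Complex.conj_ofReal] at this
  by_contra h
  exact hne (by exact_mod_cast mul_right_cancel₀ h this)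

theorem orthogonalFamily_eigenspace (hT : IsSelfAdjoint T) :
    OrthogonalFamily ℂ (fun μ : ℝ => eigenspace T (μ : ℂ))
      fun μ => (eigenspace T (μ : ℂ)).subtypeₗᵢ :=
  fun _ _ hne v w => eigenspace_orthogonal hT hne v.2 w.2

/-- Data exhibiting the self-adjoint operator `T` as a finite rank perturbation (in the resolvent
sense) of the inverse of a diagonal operator `G` with respect to the Hilbert basis `b`:
`T G g = g` for all `g` orthogonal to the finite dimensional space `M`. -/
structure IsComparison {ι : Type*} (T : H →ₗ.[ℂ] H) (b : HilbertBasis ι ℂ H) (ν : ι → ℝ)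
    (G : H →L[ℂ] H) (M : Submodule ℂ H) : Prop where
  selfAdjoint : IsSelfAdjoint T
  pos : ∀ i, 0 < ν i
  tendsto : Tendsto ν cofinite (nhds 0)
  diag : ∀ x i, inner ℂ (b i) (G x) = ν i * inner ℂ (b i) x
  finite : FiniteDimensional ℂ M
  mem_graph : ∀ g ∈ Mᗮ, (G g, g) ∈ T.graph

namespace IsComparison

variable {ι : Type*} {b : HilbertBasis ι ℂ H} {ν : ι → ℝ} {G : H →L[ℂ] H} {M : Submodule ℂ H}

theorem symm (C : IsComparison T b ν G M) (x y : H) : inner ℂ (G x) y = inner ℂ x (G y) := by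
  rw [← b.tsum_inner_mul_inner, ← b.tsum_inner_mul_inner]
  congr 1
  funext i
  rw [← inner_conj_symm (G x), C.diag, C.diag, map_mul, Complex.conj_ofReal, inner_conj_symm]
  ring

theorem injective (C : IsComparison T b ν G M) {x : H} (h : G x = 0) : x = 0 := by
  apply hilbertBasis_ext b
  intro i
  have := C.diag x i
  rw [h, inner_zero_right, zero_eq_mul] at this
  rw [inner_zero_right]
  exact this.resolve_left (by exact_mod_cast (C.pos i).ne')

/-- For `u ∈ Mᗮ`, symmetry of `T` on the pairs `(G u, u)` and `(f, g)` gives `⟪u, f⟫ = ⟪G u, g⟫ =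
⟪u, G g⟫`. Hence `f - G g ∈ Mᗮᗮ = M`, as `M` has finite dimension. -/
theorem sub_mem (C : IsComparison T b ν G M) {f g : H} (h : (f, g) ∈ T.graph) : f - G g ∈ M := by
  have := C.finite
  rw [← Submodule.orthogonal_orthogonal M, Submodule.mem_orthogonal]
  intro u hu
  rw [inner_sub_right, sub_eq_zero, ← C.symm]
  exact graph_symm C.selfAdjoint (C.mem_graph u hu) h

theorem finite_le (C : IsComparison T b ν G M) (c : ℝ) : {i | (ν i)⁻¹ ≤ c}.Finite := by
  by_cases hc : 0 < c
  · have := C.tendsto.eventually (gt_mem_nhds (inv_pos.mpr hc))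
    rw [Filter.eventually_cofinite] at this
    refine this.subset fun i hi => ?_
    simp only [mem_ofPred_eq, not_lt] at hi ⊢
    exact (inv_le_comm₀ (C.pos i) hc).mp hi
  · convert Set.finite_empty
    ext i
    simp only [mem_ofPred_eq, mem_empty_iff_false, iff_false, not_le]
    exact (not_lt.mp hc).trans_lt (inv_pos.mpr (C.pos i))

/-- Upper dimension bound. -/
theorem finrank_le (C : IsComparison T b ν G M) {X : Type*} [AddCommGroup X] [Module ℂ X] (c : ℝ)
    (j : X →ₗ[ℂ] H × H) (hj : Function.Injective j) (hmem : ∀ x, j x ∈ T.graph)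
    (hle : ∀ x, (inner ℂ (j x).2 (j x).1).re ≤ c * ‖(j x).1‖ ^ 2) :
    FiniteDimensional ℂ X ∧
      Module.finrank ℂ X ≤ {i | (ν i)⁻¹ ≤ c}.ncard + Module.finrank ℂ M := by
  have := C.finite
  have : Finite {i | (ν i)⁻¹ ≤ c} := C.finite_le c
  have : Fintype {i | (ν i)⁻¹ ≤ c} := Fintype.ofFinite _
  let A : X →ₗ[ℂ] ({i | (ν i)⁻¹ ≤ c} → ℂ) :=
    LinearMap.pi fun i => (innerₛₗ ℂ (b i)) ∘ₗ LinearMap.fst ℂ H H ∘ₗ j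
  let B : X →ₗ[ℂ] M :=
    ((LinearMap.fst ℂ H H - G.toLinearMap ∘ₗ LinearMap.snd ℂ H H) ∘ₗ j).codRestrict M
      fun x => C.sub_mem (hmem x)
  -- In the kernel, `f = G g` has no modes with `(ν i)⁻¹ ≤ c`; unless `f = 0`, this forces `⟪g, f⟫ >
  -- c ‖f‖²`, against `hle`.
  have hinj : Function.Injective (A.prod B) := by
    rw [injective_iff_map_eq_zero]
    intro x hx
    have hA : ∀ i, (ν i)⁻¹ ≤ c → inner ℂ (b i) (j x).1 = 0 := fun i hi =>
      congrFun (congrArg Prod.fst hx) ⟨i, hi⟩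
    have hB : (j x).1 = G (j x).2 := by
      have := congrArg Subtype.val (congrArg Prod.snd hx)
      exact sub_eq_zero.mp this
    have h0 : (j x).1 = 0 := by
      by_contra h0
      refine absurd (lt_re_inner_of_coeff b (m := fun i => (ν i)⁻¹) h0 (h := (j x).2) (fun i => ?_)
        fun i hi => ?_) (not_lt.mpr (hle x))
      · rw [hB, C.diag, ← mul_assoc, Complex.ofReal_inv, inv_mul_cancel₀, one_mul]
        exact_mod_cast (C.pos i).ne'
      · by_contra hi'
        exact hi (hA i (not_lt.mp hi'))
    apply hj
    rw [map_zero]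
    exact Prod.ext h0 (C.injective (by rw [← hB, h0]))
  refine ⟨FiniteDimensional.of_injective _ hinj, ?_⟩
  refine (LinearMap.finrank_le_finrank_of_injective hinj).trans_eq ?_
  rw [Module.finrank_prod, Module.finrank_fintype_fun_eq_card, ← Nat.card_eq_fintype_card,
    Nat.card_coe_set_eq]

/-- `finrank_le` does not presuppose finite dimension, so it yields finite multiplicity before any
counting. -/
theorem finiteDimensional_eigenspace_real (C : IsComparison T b ν G M) (μ : ℝ) :
    FiniteDimensional ℂ (eigenspace T (μ : ℂ)) := by
  refine (C.finrank_le μ ((LinearMap.id.prod ((μ : ℂ) • LinearMap.id)) ∘ₗ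
    (eigenspace T (μ : ℂ)).subtype) ?_ ?_ ?_).1
  · intro x y h
    exact Subtype.ext (congrArg Prod.fst h)
  · intro x
    exact mem_eigenspace_iff.mp x.2
  · intro x
    change (inner ℂ ((μ : ℂ) • (x : H)) (x : H)).re ≤ _
    rw [inner_smul_left, Complex.conj_ofReal, Complex.re_ofReal_mul]
    exact (congrArg (μ * ·) (inner_self_eq_norm_sq (𝕜 := ℂ) (x : H))).le

theorem finiteDimensional_eigenspace (C : IsComparison T b ν G M) (μ : ℂ) :
    FiniteDimensional ℂ (eigenspace T μ) := by
  by_cases h : μ.im = 0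
  · have := C.finiteDimensional_eigenspace_real μ.re
    rwa [show (μ.re : ℂ) = μ from Complex.ext rfl (by simp [h])] at this
  · have : eigenspace T μ = ⊥ := by
      rw [Submodule.eq_bot_iff]
      intro f hf
      by_contra h0
      exact h (eigenvalue_im C.selfAdjoint hf h0)
    rw [this]
    infer_instance

/-- Eigenspaces are mutually orthogonal, so on their direct sum the form is `∑ μ ‖v μ‖² ≤ c ‖∑ v
μ‖²`, and `finrank_le` applies to the whole sum. -/
theorem sum_finrank_le (C : IsComparison T b ν G M) (c : ℝ) (F : Finset ℝ) (hF : ∀ μ ∈ F, μ ≤ c) :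
    ∑ μ ∈ F, Module.finrank ℂ (eigenspace T (μ : ℂ)) ≤
      {i | (ν i)⁻¹ ≤ c}.ncard + Module.finrank ℂ M := by
  classical
  have := fun μ => C.finiteDimensional_eigenspace_real μ
  have hO := (orthogonalFamily_eigenspace C.selfAdjoint).comp
    (Subtype.val_injective (p := fun μ => μ ∈ F))
  let S : (∀ μ : F, eigenspace T ((μ : ℝ) : ℂ)) →ₗ[ℂ] H :=
    LinearMap.lsum ℂ _ ℂ fun μ => (eigenspace T ((μ : ℝ) : ℂ)).subtype
  let S' : (∀ μ : F, eigenspace T ((μ : ℝ) : ℂ)) →ₗ[ℂ] H :=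
    LinearMap.lsum ℂ _ ℂ fun μ => ((μ : ℝ) : ℂ) • (eigenspace T ((μ : ℝ) : ℂ)).subtype
  have hS : ∀ v, S v = ∑ μ, (v μ : H) := fun v => by simp [S]
  have hS' : ∀ v, S' v = ∑ μ : F, ((μ : ℝ) : ℂ) • (v μ : H) := fun v => by simp [S']
  have hn : ∀ v, ‖S v‖ ^ 2 = ∑ μ, ‖v μ‖ ^ 2 := fun v => by
    rw [hS]
    exact hO.norm_sum v Finset.univ
  have key := (C.finrank_le c (S.prod S') ?_ ?_ ?_).2
  · rwa [Module.finrank_pi_fintype, Finset.sum_coe_sort F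
      (fun μ => Module.finrank ℂ (eigenspace T (μ : ℂ)))] at key
  · rw [injective_iff_map_eq_zero]
    intro v hv
    have h0 := hn v
    rw [show S v = 0 from congrArg Prod.fst hv, norm_zero, zero_pow two_ne_zero, eq_comm,
      Finset.sum_eq_zero_iff_of_nonneg (fun _ _ => by positivity)] at h0
    funext μ
    simpa using h0 μ (Finset.mem_univ _)
  · intro v
    have : (S.prod S') v = ∑ μ : F, ((v μ : H), ((μ : ℝ) : ℂ) • (v μ : H)) := by
      apply Prod.ext
      · rw [Prod.fst_sum]
        exact hS v
      · rw [Prod.snd_sum]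
        exact hS' v
    rw [this]
    exact Submodule.sum_mem _ fun μ _ => mem_eigenspace_iff.mp (v μ).2
  · intro v
    change (inner ℂ (S' v) (S v)).re ≤ c * ‖S v‖ ^ 2
    have h1 : inner ℂ (S' v) (S v) = ∑ μ : F, ((μ : ℝ) : ℂ) * inner ℂ (v μ) (v μ) := by
      rw [hS, hS']
      have := hO.inner_sum (fun μ => ((μ : ℝ) : ℂ) • v μ) v Finset.univ
      refine this.trans (Finset.sum_congr rfl fun μ _ => ?_)
      rw [inner_smul_left, Complex.conj_ofReal]
    rw [h1, hn, Finset.mul_sum, Complex.re_sum]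
    refine Finset.sum_le_sum fun μ _ => ?_
    rw [Complex.re_ofReal_mul, show (inner ℂ (v μ) (v μ)).re = ‖v μ‖ ^ 2 from
      inner_self_eq_norm_sq (𝕜 := ℂ) (v μ)]
    exact mul_le_mul_of_nonneg_right (hF μ μ.2) (by positivity)

theorem finite_eigenvalues (C : IsComparison T b ν G M) (c : ℝ) :
    {μ : ℝ | IsEigenvalue T (μ : ℂ) ∧ μ ≤ c}.Finite := by
  by_contra h
  obtain ⟨F, hF, hcard⟩ := Set.Infinite.exists_subset_card_eq h
    ({i | (ν i)⁻¹ ≤ c}.ncard + Module.finrank ℂ M + 1)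
  have h1 := C.sum_finrank_le c F fun μ hμ => (hF hμ).2
  have h2 : ∑ μ ∈ F, 1 ≤ ∑ μ ∈ F, Module.finrank ℂ (eigenspace T (μ : ℂ)) := by
    refine Finset.sum_le_sum fun μ hμ => ?_
    have := C.finiteDimensional_eigenspace_real μ
    exact Submodule.one_le_finrank_iff.mpr (hF hμ).1
  rw [Finset.sum_const, hcard, smul_eq_mul] at h2
  omega

/-- Rules out the default value 0 of `finsum`: the support is finite, and finite multiplicity makes
`finrank` vanish only off the spectrum of eigenvalues. -/
theorem eigenvalueCount_eq (C : IsComparison T b ν G M) (K : ℝ) : eigenvalueCount T K =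
    ∑ μ ∈ (C.finite_eigenvalues (K ^ 2)).toFinset, Module.finrank ℂ (eigenspace T (μ : ℂ)) := by
  refine finsum_mem_eq_sum_of_inter_support_eq _ (s := {μ : ℝ | μ ≤ K ^ 2}) ?_
  ext μ
  have := C.finiteDimensional_eigenspace_real μ
  have hiff : Module.finrank ℂ (eigenspace T (μ : ℂ)) ≠ 0 ↔ IsEigenvalue T (μ : ℂ) := by
    rw [IsEigenvalue, Ne, Ne, Submodule.finrank_eq_zero]
  simp only [mem_inter_iff, mem_ofPred_eq, Function.mem_support, hiff, Finite.coe_toFinset]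
  tauto

theorem eigenvalueCount_le (C : IsComparison T b ν G M) (K : ℝ) :
    eigenvalueCount T K ≤ {i | (ν i)⁻¹ ≤ K ^ 2}.ncard + Module.finrank ℂ M := by
  rw [C.eigenvalueCount_eq]
  refine C.sum_finrank_le _ _ fun μ hμ => ?_
  simp only [Finite.mem_toFinset] at hμ
  exact hμ.2

end IsComparison

end SelfAdjoint

end QuantumGraph

namespace QuantumGraph

/-! ### Compact resolvent, eigenbasis, and the lower bound. -/

section Resolvent

variable {H : Type*} [NormedAddCommGroup H] [InnerProductSpace ℂ H] [CompleteSpace H]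
  {T : H →ₗ.[ℂ] H}

namespace IsComparison

variable {ι : Type*} {b : HilbertBasis ι ℂ H} {ν : ι → ℝ} {G : H →L[ℂ] H} {M : Submodule ℂ H}

/-- A short interval has infinitely many points but only finitely many eigenvalues. Smallness of `c`
makes `1 - c G` invertible. -/
theorem exists_small_not_eigenvalue (C : IsComparison T b ν G M) :
    ∃ c : ℝ, ‖(c : ℂ) • G‖ < 1 ∧ eigenspace T (c : ℂ) = ⊥ := by
  have hpos : 0 < 1 / (‖G‖ + 1) := by positivity
  obtain ⟨c, hc, hc'⟩ := ((Ioo_infinite hpos).sdiff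
    (C.finite_eigenvalues (1 / (‖G‖ + 1)))).nonempty
  refine ⟨c, ?_, ?_⟩
  · rw [norm_smul, Complex.norm_real, Real.norm_eq_abs, abs_of_pos hc.1]
    have h1 := (lt_div_iff₀ (by positivity)).mp hc.2
    nlinarith [hc.1]
  · by_contra h
    exact hc' ⟨h, hc.2.le⟩

/-- The range of `T - c` is closed, because it contains a closed subspace of finite codimension, and
its orthogonal complement is the eigenspace at `c`, which is trivial. -/
theorem exists_mem_graph_shift (C : IsComparison T b ν G M) {c : ℝ} (hc : ‖(c : ℂ) • G‖ < 1)
    (hc' : eigenspace T (c : ℂ) = ⊥) (h : H) : ∃ f, (f, h + (c : ℂ) • f) ∈ T.graph := by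
  have := C.finite
  let L : H × H →ₗ[ℂ] H := LinearMap.snd ℂ H H - (c : ℂ) • LinearMap.fst ℂ H H
  let S : Submodule ℂ H := T.graph.map L
  let e : H ≃L[ℂ] H := ContinuousLinearEquiv.unitsEquiv ℂ H (Units.oneSub _ hc)
  have he : ∀ u, e u = u - (c : ℂ) • G u := fun u => rfl
  -- On `Mᗮ`, `(T - c) (G u) = u - c G u = e u`.
  have hle : Mᗮ ≤ S.comap e.toLinearMap := fun u hu => ⟨(G u, u), C.mem_graph u hu, rfl⟩
  have hfin : FiniteDimensional ℂ (H ⧸ Mᗮ) :=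
    (Submodule.quotientEquivOfIsCompl Mᗮ M M.isCompl_orthogonal.symm).symm.finiteDimensional
  have hclosed : IsClosed (S : Set H) := by
    have h1 := Submodule.isClosed_mono_of_finiteDimensional_quotient
      (Submodule.isClosed_orthogonal M) hle
    exact e.toHomeomorph.isClosed_preimage.mp h1
  have : CompleteSpace S := hclosed.completeSpace_coe
  have hS : S = ⊤ := by
    rw [← Submodule.orthogonal_eq_bot_iff, Submodule.eq_bot_iff]
    intro k hk
    have hmem : k ∈ eigenspace T (c : ℂ) := by
      rw [mem_eigenspace_iff]
      refine mem_graph_of_symm C.selfAdjoint fun f' g' hf' => ?_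
      have h0 : inner ℂ k (g' - (c : ℂ) • f') = 0 :=
        (Submodule.mem_orthogonal' S k).mp hk _ ⟨(f', g'), hf', rfl⟩
      rw [inner_sub_right, sub_eq_zero, inner_smul_right] at h0
      rw [h0, inner_smul_left, Complex.conj_ofReal]
    rw [hc'] at hmem
    exact hmem
  obtain ⟨⟨f, g⟩, hp, hp'⟩ : h ∈ S := by rw [hS]; trivial
  refine ⟨f, ?_⟩
  have : h + (c : ℂ) • f = g := by
    rw [← hp']
    exact sub_add_cancel _ _
  rwa [this]

/-- The resolvent at a suitable real point exists and is compact and symmetric. -/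
theorem exists_resolvent (C : IsComparison T b ν G M) : ∃ (c : ℝ) (R : H →L[ℂ] H),
    IsCompactOperator R ∧ (R : H →ₗ[ℂ] H).IsSymmetric ∧ ∀ h, (R h, h + (c : ℂ) • R h) ∈ T.graph := by
  obtain ⟨c, hc, hc'⟩ := C.exists_small_not_eigenvalue
  have := C.finite
  choose R hR using C.exists_mem_graph_shift hc hc'
  -- Injectivity of `T - c` makes the pointwise choice `R` linear.
  have huniq : ∀ {f h}, (f, h + (c : ℂ) • f) ∈ T.graph → R h = f := by
    intro f h hf
    have h1 := T.graph.sub_mem (hR h) hf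
    have h2 : R h - f ∈ eigenspace T (c : ℂ) := by
      rw [mem_eigenspace_iff]
      convert h1 using 1
      apply Prod.ext
      · rfl
      · simp [smul_sub]
    rw [hc'] at h2
    exact sub_eq_zero.mp h2
  let R' : H →ₗ[ℂ] H :=
    { toFun := R
      map_add' := fun x y => huniq (by
        convert T.graph.add_mem (hR x) (hR y) using 1
        apply Prod.ext
        · rfl
        · simp only [Prod.mk_add_mk, smul_add]
          abel)
      map_smul' := fun a x => huniq (by
        convert T.graph.smul_mem a (hR x) using 1
        apply Prod.ext
        · rfl
        · simp only [Prod.smul_mk, smul_add, RingHom.id_apply]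
          rw [smul_comm]) }
  have hsymm : R'.IsSymmetric := by
    intro x y
    have := graph_symm C.selfAdjoint (hR x) (hR y)
    rw [inner_add_left, inner_add_right, inner_smul_left, inner_smul_right,
      Complex.conj_ofReal] at this
    exact (add_right_cancel this).symm
  -- Hellinger–Toeplitz: a symmetric operator defined everywhere is bounded.
  let R'' : H →L[ℂ] H := ⟨R', hsymm.continuous⟩
  refine ⟨c, R'', ?_, hsymm, hR⟩
  -- By `sub_mem`, `R h - G (h + c R h) ∈ M`, so `R` is compact plus finite rank.
  have hG := isCompactOperator_diagonal b C.tendsto C.diag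
  have h1 := hG.comp_clm (ContinuousLinearMap.id ℂ H + (c : ℂ) • R'')
  have h2 := isCompactOperator_of_forall_mem (M := M)
    (R'' - G.comp (ContinuousLinearMap.id ℂ H + (c : ℂ) • R'')) fun x => C.sub_mem (hR x)
  have hsum : (R'' : H → H) = G ∘ (ContinuousLinearMap.id ℂ H + (c : ℂ) • R'') +
      (R'' - G.comp (ContinuousLinearMap.id ℂ H + (c : ℂ) • R'')) := by
    funext x
    simp
  rw [hsum]
  exact h1.add h2

/-- The spectral theorem for the compact `R` suffices: `R f = z f` means `T f = (z⁻¹ + c) f`, and `z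
= 0` is excluded because `R` is injective. -/
theorem orthogonal_iSup_eigenspace (C : IsComparison T b ν G M) :
    (⨆ μ : ℝ, eigenspace T (μ : ℂ))ᗮ = ⊥ := by
  obtain ⟨c, R, hR, hsymm, hgraph⟩ := C.exists_resolvent
  rw [eq_bot_iff, ← ContinuousLinearMap.orthogonalComplement_iSup_eigenspaces_eq_bot hR hsymm]
  apply Submodule.orthogonal_le
  refine iSup_le fun z f hf => ?_
  have hf : R f = z • f := Module.End.mem_eigenspace_iff.mp hf
  have hg := hgraph f
  by_cases h0 : f = 0
  · rw [h0]
    exact Submodule.zero_mem _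
  rw [hf] at hg
  by_cases hz : z = 0
  · rw [hz, zero_smul, smul_zero, add_zero] at hg
    exact absurd (T.graph_fst_eq_zero_snd hg rfl) h0
  have hmem : f ∈ eigenspace T (z⁻¹ + c) := by
    rw [mem_eigenspace_iff]
    convert T.graph.smul_mem z⁻¹ hg using 1
    rw [Prod.smul_mk, smul_add, smul_comm _ (c : ℂ), inv_smul_smul₀ hz, add_smul]
  have him := eigenvalue_im C.selfAdjoint hmem h0
  rw [show z⁻¹ + (c : ℂ) = (((z⁻¹ + c : ℂ).re : ℝ) : ℂ) from Complex.ext rfl (by simpa using him)]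
    at hmem
  exact Submodule.mem_iSup_of_mem (p := fun μ : ℝ => eigenspace T (μ : ℂ)) _ hmem

theorem exists_eigenbasis (C : IsComparison T b ν G M) :
    ∃ (κ : Type) (d : HilbertBasis κ ℂ H) (m : κ → ℝ), ∀ k, d k ∈ eigenspace T (m k : ℂ) := by
  have := C.finiteDimensional_eigenspace_real
  have hO := (orthogonalFamily_eigenspace C.selfAdjoint).orthonormal_sigma_orthonormal
    (v_family := fun μ : ℝ => stdOrthonormalBasis ℂ (eigenspace T (μ : ℂ)))
    fun μ => (stdOrthonormalBasis ℂ (eigenspace T (μ : ℂ))).orthonormal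
  have hsp := C.orthogonal_iSup_eigenspace
  refine ⟨_, HilbertBasis.mkOfOrthogonalEqBot hO ?_, fun k => k.1, fun k => ?_⟩
  · rw [eq_bot_iff, ← hsp]
    apply Submodule.orthogonal_le
    refine iSup_le fun μ f hf => ?_
    have h1 : (⟨f, hf⟩ : eigenspace T (μ : ℂ)) ∈
        Submodule.span ℂ (range (stdOrthonormalBasis ℂ (eigenspace T (μ : ℂ)))) := by
      rw [← OrthonormalBasis.coe_toBasis, Module.Basis.span_eq]
      trivial
    have h2 := Submodule.mem_map_of_mem (f := (eigenspace T (μ : ℂ)).subtype) h1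
    rw [Submodule.map_span] at h2
    refine Submodule.span_mono ?_ h2
    rintro _ ⟨_, ⟨i, rfl⟩, rfl⟩
    exact ⟨⟨μ, i⟩, rfl⟩
  · rw [HilbertBasis.coe_mkOfOrthogonalEqBot]
    exact (stdOrthonormalBasis ℂ (eigenspace T ((k.1 : ℝ) : ℂ)) k.2).2

theorem lt_re_inner_of_orthogonal (C : IsComparison T b ν G M) {c : ℝ} {f g : H}
    (hfg : (f, g) ∈ T.graph) (hf : f ≠ 0)
    (horth : ∀ μ : ℝ, μ ≤ c → ∀ k ∈ eigenspace T (μ : ℂ), inner ℂ k f = 0) :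
    c * ‖f‖ ^ 2 < (inner ℂ g f).re := by
  obtain ⟨κ, d, m, hd⟩ := C.exists_eigenbasis
  refine lt_re_inner_of_coeff d (m := m) hf (fun k => ?_) fun k hk => ?_
  · rw [← graph_symm C.selfAdjoint (mem_eigenspace_iff.mp (hd k)) hfg, inner_smul_left,
      Complex.conj_ofReal]
  · by_contra h
    exact hk (horth _ (not_lt.mp h) _ (hd k))

theorem le_eigenvalueCount (C : IsComparison T b ν G M) (K : ℝ) :
    {i | (ν i)⁻¹ ≤ K ^ 2}.ncard ≤ eigenvalueCount T K + Module.finrank ℂ M := by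
  classical
  have := C.finite
  have := C.finiteDimensional_eigenspace_real
  rw [C.eigenvalueCount_eq]
  set F := (C.finite_eigenvalues (K ^ 2)).toFinset with hF
  have : Finite {i | (ν i)⁻¹ ≤ K ^ 2} := C.finite_le _
  have : Fintype {i | (ν i)⁻¹ ≤ K ^ 2} := Fintype.ofFinite _
  by_contra! hlt
  let B : ({i | (ν i)⁻¹ ≤ K ^ 2} → ℂ) →ₗ[ℂ] H :=
    Fintype.linearCombination ℂ (fun i : {i | (ν i)⁻¹ ≤ K ^ 2} => b i)
  have hB : ∀ a i, inner ℂ (b i) (B a) = if h : (ν i)⁻¹ ≤ K ^ 2 then a ⟨i, h⟩ else 0 := by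
    intro a i
    simp only [B, Fintype.linearCombination_apply, inner_sum, inner_smul_right,
      orthonormal_iff_ite.mp b.orthonormal, mul_ite, mul_one, mul_zero]
    split_ifs with h
    · rw [Finset.sum_eq_single ⟨i, h⟩]
      · simp
      · intro j _ hj
        rw [if_neg]
        rintro rfl
        exact hj rfl
      · simp
    · refine Finset.sum_eq_zero fun j _ => if_neg ?_
      rintro rfl
      exact h j.2
  -- Were there too few eigenvalues, some nonzero combination `B a` of low modes would be orthogonal
  -- to `M` with `G (B a)` orthogonal to all low eigenspaces. The form at `G (B a)` would then
  -- exceed `K² ‖G (B a)‖²`, which is impossible since `G` preserves low modes.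
  let A : ({i | (ν i)⁻¹ ≤ K ^ 2} → ℂ) →ₗ[ℂ] M × (∀ μ : F, eigenspace T ((μ : ℝ) : ℂ)) :=
    (M.orthogonalProjectionOnto.toLinearMap ∘ₗ B).prod (LinearMap.pi fun μ =>
      (eigenspace T ((μ : ℝ) : ℂ)).orthogonalProjectionOnto.toLinearMap ∘ₗ G.toLinearMap ∘ₗ B)
  have hker : LinearMap.ker A ≠ ⊥ := by
    apply LinearMap.ker_ne_bot_of_finrank_lt
    rw [Module.finrank_prod, Module.finrank_pi_fintype, Finset.sum_coe_sort F
      (fun μ => Module.finrank ℂ (eigenspace T (μ : ℂ))), Module.finrank_fintype_fun_eq_card,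
      ← Nat.card_eq_fintype_card, Nat.card_coe_set_eq, add_comm]
    exact hlt
  obtain ⟨a, ha, ha0⟩ := Submodule.exists_mem_ne_zero_of_ne_bot hker
  rw [LinearMap.mem_ker] at ha
  have hM : B a ∈ Mᗮ := by
    rw [← Submodule.orthogonalProjectionOnto_eq_zero_iff]
    exact congrArg Prod.fst ha
  have hE : ∀ μ : ℝ, μ ≤ K ^ 2 → ∀ k ∈ eigenspace T (μ : ℂ), inner ℂ k (G (B a)) = 0 := by
    intro μ hμ k hk
    by_cases hk0 : k = 0
    · rw [hk0, inner_zero_left]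
    have hμF : μ ∈ F := by
      rw [hF, Finite.mem_toFinset]
      refine ⟨?_, hμ⟩
      intro hbot
      rw [hbot] at hk
      exact hk0 hk
    have h1 : G (B a) ∈ (eigenspace T (μ : ℂ))ᗮ := by
      rw [← Submodule.orthogonalProjectionOnto_eq_zero_iff]
      exact congrFun (congrArg Prod.snd ha) ⟨μ, hμF⟩
    exact (Submodule.mem_orthogonal _ _).mp h1 k hk
  have hBa : B a ≠ 0 := by
    intro h0
    apply ha0
    funext i
    have := hB a i
    rw [h0, inner_zero_right, dif_pos (show (ν i)⁻¹ ≤ K ^ 2 from i.2)] at this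
    exact this.symm
  have hGB : G (B a) ≠ 0 := fun h => hBa (C.injective h)
  have hlt' := C.lt_re_inner_of_orthogonal (C.mem_graph _ hM) hGB hE
  refine absurd (re_inner_le_of_coeff b (m := fun i => (ν i)⁻¹) (fun i => ?_) fun i hi => ?_)
    (not_le.mpr hlt')
  · rw [C.diag, ← mul_assoc, Complex.ofReal_inv, inv_mul_cancel₀, one_mul]
    exact_mod_cast (C.pos i).ne'
  · by_contra hi'
    apply hi
    rw [C.diag, hB, dif_neg hi', mul_zero]

end IsComparison

end Resolvent

end QuantumGraph

namespace QuantumGraph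

/-! ### One edge: primitives, Fourier modes, and the equation `-f'' = g`. -/

section Interval

variable {l : ℝ}

theorem memLp_of_continuous {u : ℝ → ℂ} (hu : Continuous u) :
    MemLp u 2 (volume.restrict (Ioo 0 l)) := by
  obtain ⟨C, hC⟩ := (isCompact_Icc (a := 0) (b := l)).exists_bound_of_continuousOn hu.continuousOn
  refine MemLp.of_bound hu.aestronglyMeasurable C ?_
  rw [ae_restrict_iff' measurableSet_Ioo]
  exact Eventually.of_forall fun x hx => hC x (Ioo_subset_Icc_self hx)

/-- The class in `L²(0, l)` of a continuous function. -/
noncomputable def ofContinuous (l : ℝ) (u : ℝ → ℂ) (hu : Continuous u) : L2Interval l :=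
  (memLp_of_continuous hu).toLp u

theorem coeFn_ofContinuous {u : ℝ → ℂ} (hu : Continuous u) :
    ofContinuous l u hu =ᵐ[volume.restrict (Ioo 0 l)] u :=
  MemLp.coeFn_toLp _

theorem inner_ofContinuous (hl : 0 < l) {u w : ℝ → ℂ} (hu : Continuous u) {f : L2Interval l}
    (hf : f =ᵐ[volume.restrict (Ioo 0 l)] w) :
    inner ℂ (ofContinuous l u hu) f = ∫ x in 0..l, (starRingEnd ℂ) (u x) * w x := by
  rw [L2.inner_def, intervalIntegral.integral_of_le hl.le, integral_Ioc_eq_integral_Ioo]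
  refine integral_congr_ae ?_
  filter_upwards [coeFn_ofContinuous hu, hf] with x h1 h2
  rw [h1, h2, RCLike.inner_apply, mul_comm]

/-- Integration by parts against the primitive of an integrable function. -/
theorem integral_deriv_mul_primitive (hl : 0 < l) {φ φ' g : ℝ → ℂ}
    (hφ : ∀ x, HasDerivAt φ (φ' x) x) (hφ' : Continuous φ')
    (hg : ∀ a b, IntervalIntegrable g volume a b) :
    ∫ x in 0..l, φ' x * ∫ t in 0..x, g t =
      φ l * (∫ t in 0..l, g t) - ∫ x in 0..l, φ x * g x := by
  have hgi : IntegrableOn g (Ioc 0 l) := (hg 0 l).1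
  have hφi : IntegrableOn φ' (Ioc 0 l) := (hφ'.intervalIntegrable 0 l).1
  have hφc : Continuous φ := continuous_iff_continuousAt.mpr fun x => (hφ x).continuousAt
  have hm : MeasurableSet {p : ℝ × ℝ | p.2 ≤ p.1} := measurableSet_le measurable_snd measurable_fst
  -- Fubini on the triangle `t ≤ x`; `g` is only integrable, so its primitive need not be
  -- differentiable everywhere.
  have hint : Integrable (Function.uncurry fun x t : ℝ =>
      ({p : ℝ × ℝ | p.2 ≤ p.1}.indicator (fun p => φ' p.1 * g p.2) (x, t)))
      ((volume.restrict (Ioc 0 l)).prod (volume.restrict (Ioc 0 l))) :=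
    (hφi.mul_prod hgi).indicator hm
  have hswap := integral_integral_swap hint
  have hleft : ∀ x ∈ Ioc 0 l, ∫ t in Ioc 0 l,
      ({p : ℝ × ℝ | p.2 ≤ p.1}.indicator (fun p => φ' p.1 * g p.2) (x, t)) =
      φ' x * ∫ t in 0..x, g t := by
    intro x hx
    rw [intervalIntegral.integral_of_le hx.1.le, ← integral_const_mul,
      show Ioc 0 x = Ioc 0 l ∩ Iic x by rw [Ioc_inter_Iic, min_eq_right hx.2],
      ← setIntegral_indicator measurableSet_Iic]
    rfl
  have hright : ∀ t ∈ Ioc 0 l, ∫ x in Ioc 0 l,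
      ({p : ℝ × ℝ | p.2 ≤ p.1}.indicator (fun p => φ' p.1 * g p.2) (x, t)) =
      φ l * g t - φ t * g t := by
    intro t ht
    have h1 : ∫ x in t..l, φ' x * g t = (φ l - φ t) * g t := by
      rw [intervalIntegral.integral_mul_const, intervalIntegral.integral_eq_sub_of_hasDerivAt
        (fun x _ => hφ x) (hφ'.intervalIntegrable _ _)]
    rw [← sub_mul, ← h1, intervalIntegral.integral_of_le ht.2, ← integral_Icc_eq_integral_Ioc (x := t),
      show Icc t l = Ioc 0 l ∩ Ici t by
        ext x
        simp only [mem_Icc, mem_inter_iff, mem_Ioc, mem_Ici]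
        exact ⟨fun h => ⟨⟨ht.1.trans_le h.1, h.2⟩, h.1⟩, fun h => ⟨h.2, h.1.2⟩⟩,
      ← setIntegral_indicator measurableSet_Ici]
    rfl
  rw [setIntegral_congr_fun measurableSet_Ioc hleft,
    setIntegral_congr_fun measurableSet_Ioc hright] at hswap
  rw [intervalIntegral.integral_of_le hl.le, hswap, ← intervalIntegral.integral_of_le hl.le,
    intervalIntegral.integral_sub ((hg 0 l).const_mul _)
      ((hg 0 l).continuousOn_mul hφc.continuousOn), intervalIntegral.integral_const_mul]

theorem hasWeakDeriv_primitive (hl : 0 < l) {w : ℝ → ℂ}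
    (hw : ∀ a b, IntervalIntegrable w volume a b) {f g : L2Interval l}
    (hg : g =ᵐ[volume.restrict (Ioo 0 l)] w)
    (hf : f =ᵐ[volume.restrict (Ioo 0 l)] fun x => ∫ t in 0..x, w t) : HasWeakDeriv f g := by
  intro φ h1 h2 h3
  have hd : Continuous (deriv φ) := h1.continuous_deriv (by simp)
  -- Only the boundary term at `l` matters, since the primitive vanishes at 0.
  have hφl : φ l = 0 := image_eq_zero_of_notMem_tsupport fun h => lt_irrefl _ (h3 h).2
  have key := integral_deriv_mul_primitive hl (φ := fun x => (φ x : ℂ))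
    (φ' := fun x => ((deriv φ x : ℝ) : ℂ))
    (fun x => ((h1.differentiable (by simp)) x).hasDerivAt.ofReal_comp)
    (Complex.continuous_ofReal.comp hd) hw
  rw [hφl, Complex.ofReal_zero, zero_mul, zero_sub, intervalIntegral.integral_of_le hl.le,
    intervalIntegral.integral_of_le hl.le, integral_Ioc_eq_integral_Ioo,
    integral_Ioc_eq_integral_Ioo] at key
  rw [integral_congr_ae (g := fun x => ((deriv φ x : ℝ) : ℂ) * ∫ t in 0..x, w t), key,
    integral_congr_ae (f := fun x => φ x • g x) (g := fun x => (φ x : ℂ) * w x)]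
  · filter_upwards [hg] with x hx
    rw [hx, Complex.real_smul]
  · filter_upwards [hf] with x hx
    rw [hx, Complex.real_smul]

/-- The phase `2 π i n / l`. -/
noncomputable def phase (l : ℝ) (n : ℤ) : ℂ := 2 * Real.pi * Complex.I * n / l

theorem conj_phase (n : ℤ) : (starRingEnd ℂ) (phase l n) = -phase l n := by
  simp [phase, neg_div, Complex.conj_ofNat]

theorem exp_phase_mul_length (hl : 0 < l) (n : ℤ) : Complex.exp (phase l n * l) = 1 := by
  have : (l : ℂ) ≠ 0 := by exact_mod_cast hl.ne'
  rw [phase, div_mul_cancel₀ _ this, Complex.exp_eq_one_iff]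
  exact ⟨n, by ring⟩

theorem phase_ne_zero (hl : 0 < l) {n : ℤ} (hn : n ≠ 0) : phase l n ≠ 0 := by
  have : (l : ℂ) ≠ 0 := by exact_mod_cast hl.ne'
  have : (n : ℂ) ≠ 0 := by exact_mod_cast hn
  have : (Real.pi : ℂ) ≠ 0 := by exact_mod_cast Real.pi_ne_zero
  simp [phase, *]

/-- The normalised exponential `x ↦ exp (2 π i n x / l) / √l` in `L²(0, l)`. -/
noncomputable def wave (l : ℝ) (n : ℤ) : L2Interval l :=
  ofContinuous l (fun x => ((√l)⁻¹ : ℝ) * Complex.exp (phase l n * x)) (by fun_prop)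

theorem inner_wave (hl : 0 < l) (n : ℤ) {f : L2Interval l} {w : ℝ → ℂ}
    (hf : f =ᵐ[volume.restrict (Ioo 0 l)] w) :
    inner ℂ (wave l n) f =
      ((√l)⁻¹ : ℝ) * ∫ x in 0..l, Complex.exp (-phase l n * x) * w x := by
  rw [wave, inner_ofContinuous hl _ hf, ← intervalIntegral.integral_const_mul]
  congr 1
  funext x
  rw [map_mul, Complex.conj_ofReal, ← Complex.exp_conj, map_mul, conj_phase, Complex.conj_ofReal,
    mul_assoc]

theorem orthonormal_wave (hl : 0 < l) : Orthonormal ℂ (wave l) := by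
  rw [orthonormal_iff_ite]
  intro m n
  rw [inner_wave hl m (f := wave l n)
    (w := fun x => ((√l)⁻¹ : ℝ) * Complex.exp (phase l n * x)) (coeFn_ofContinuous _)]
  have h1 : ∀ x : ℝ, Complex.exp (-phase l m * x) *
      (((√l)⁻¹ : ℝ) * Complex.exp (phase l n * x)) =
      ((√l)⁻¹ : ℝ) * Complex.exp (phase l (n - m) * x) := by
    intro x
    rw [mul_left_comm, ← Complex.exp_add]
    congr 2
    simp only [phase]
    push_cast
    ring
  simp only [h1]
  rw [intervalIntegral.integral_const_mul, ← mul_assoc, ← Complex.ofReal_mul, ← mul_inv,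
    Real.mul_self_sqrt hl.le]
  split_ifs with h
  · subst h
    have : (l : ℂ) ≠ 0 := by exact_mod_cast hl.ne'
    simp [phase, this]
  · rw [integral_exp_mul_complex (phase_ne_zero hl (sub_ne_zero.mpr (Ne.symm h))),
      exp_phase_mul_length hl]
    simp

/-- Parseval's identity for Fourier coefficients on `(0, l)`. -/
theorem eq_zero_of_inner_wave (hl : 0 < l) {f : L2Interval l}
    (hf : ∀ n, inner ℂ (wave l n) f = 0) : f = 0 := by
  have hmem : MemLp f 2 (volume.restrict (Ioc 0 l)) := by
    rw [← Measure.restrict_congr_set (Ioo_ae_eq_Ioc (μ := volume) (a := 0) (b := l))]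
    exact Lp.memLp f
  have hs : (((√l)⁻¹ : ℝ) : ℂ) ≠ 0 := by
    exact_mod_cast (inv_pos.mpr (Real.sqrt_pos.mpr hl)).ne'
  have hcoeff : ∀ n, fourierCoeffOn hl f n = 0 := by
    intro n
    have h1 := hf n
    rw [inner_wave hl n (ae_eq_refl _), mul_eq_zero, or_iff_right hs] at h1
    have h2 : ∀ x : ℝ, fourier (-n) (x : AddCircle (l - 0)) • f x =
        Complex.exp (-phase l n * x) * f x := by
      intro x
      rw [fourier_coe_apply, smul_eq_mul, phase]
      congr 2
      push_cast
      rw [sub_zero]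
      ring
    rw [fourierCoeffOn_eq_integral]
    simp only [h2]
    rw [h1, smul_zero]
  have hsum := hasSum_sq_fourierCoeffOn hl hmem
  simp only [hcoeff, norm_zero, ne_eq, OfNat.ofNat_ne_zero, not_false_eq_true, zero_pow, sub_zero,
    smul_eq_mul] at hsum
  have h0 := hsum.unique hasSum_zero
  have h2 : ∫ x in 0..l, ‖f x‖ ^ 2 = 0 := by
    rcases mul_eq_zero.mp h0 with h | h
    · exact absurd h (inv_pos.mpr hl).ne'
    · exact h
  rw [intervalIntegral.integral_of_le hl.le, integral_Ioc_eq_integral_Ioo,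
    integral_eq_zero_iff_of_nonneg (fun _ => by positivity)
      ((memLp_two_iff_integrable_sq_norm (Lp.memLp f).1).mp (Lp.memLp f))] at h2
  rw [Lp.eq_zero_iff_ae_eq_zero]
  filter_upwards [h2] with x hx
  simpa using hx

/-- The monomials `x ^ k` in `L²(0, l)`. -/
noncomputable def monomialL2 (l : ℝ) (k : ℕ) : L2Interval l :=
  ofContinuous l (fun x => (x : ℂ) ^ k) (by fun_prop)

theorem inner_monomialL2 (hl : 0 < l) (k : ℕ) {f : L2Interval l} {w : ℝ → ℂ}
    (hf : f =ᵐ[volume.restrict (Ioo 0 l)] w) :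
    inner ℂ (monomialL2 l k) f = ∫ x in 0..l, (x : ℂ) ^ k * w x := by
  rw [monomialL2, inner_ofContinuous hl _ hf]
  simp

/-- The reciprocals of the eigenvalues of the periodic Laplacian, the eigenvalue `0` being replaced
by `1`. -/
noncomputable def periodicWeight (l : ℝ) (n : ℤ) : ℝ := if n = 0 then 1 else (l / (2 * Real.pi * n)) ^ 2

/-- For `g` orthogonal to the polynomials of degree at most two, `-f'' = g` has a solution in
`H²_0(0, l)` whose Fourier coefficients are given by those of `g`. -/
theorem exists_isH2ZeroWith (hl : 0 < l) (g : L2Interval l)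
    (hg : ∀ k < 3, inner ℂ (monomialL2 l k) g = 0) :
    ∃ f : L2Interval l, IsH2ZeroWith f (-g) ∧
      ∀ n, inner ℂ (wave l n) f = periodicWeight l n * inner ℂ (wave l n) g := by
  let w : ℝ → ℂ := (Ioo 0 l).indicator g
  have hgw : g =ᵐ[volume.restrict (Ioo 0 l)] w := (indicator_ae_eq_restrict measurableSet_Ioo).symm
  have hwi : Integrable w :=
    (integrable_indicator_iff measurableSet_Ioo).mpr ((Lp.memLp g).integrable (by norm_num))
  have hw : ∀ a b, IntervalIntegrable w volume a b := fun a b => hwi.intervalIntegrable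
  let u : ℝ → ℂ := fun x => ∫ t in 0..x, w t
  have hu : Continuous u := intervalIntegral.continuous_primitive hw 0
  have hui : ∀ a b, IntervalIntegrable u volume a b := fun a b => hu.intervalIntegrable a b
  let v : ℝ → ℂ := fun x => ∫ t in 0..x, u t
  have hv : Continuous v := intervalIntegral.continuous_primitive hui 0
  simp only [inner_monomialL2 hl _ hgw] at hg
  -- Orthogonality to `1` and `x` gives `u l = 0` and `v l = 0`, the end conditions at `l`;
  -- orthogonality to `x²` gives `v` mean zero.
  have hul : u l = 0 := by simpa using hg 0 (by norm_num)
  have hvl : v l = 0 := by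
    have := integral_deriv_mul_primitive hl (φ := fun x => (x : ℂ)) (φ' := fun _ => 1)
      (fun x => Complex.ofRealCLM.hasDerivAt) continuous_const hw
    have h1 := hg 1 (by norm_num)
    simp only [pow_one] at h1
    rw [h1] at this
    change _ = (l : ℂ) * u l - 0 at this
    rw [hul, mul_zero, sub_zero] at this
    simpa only [one_mul] using this
  have hxu : ∫ x in 0..l, (x : ℂ) * u x = 0 := by
    have := integral_deriv_mul_primitive hl (φ := fun x => (x : ℂ) ^ 2 / 2) (φ' := fun x => (x : ℂ))
      (fun x => by
        have := ((Complex.ofRealCLM.hasDerivAt (x := x)).pow 2).div_const 2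
        simpa using this) Complex.continuous_ofReal hw
    have h2 := hg 2 (by norm_num)
    have h3 : ∀ x : ℝ, (x : ℂ) ^ 2 / 2 * w x = (1 / 2) * ((x : ℂ) ^ 2 * w x) := fun x => by ring
    simp only [h3] at this
    rw [intervalIntegral.integral_const_mul, h2] at this
    change _ = (l : ℂ) ^ 2 / 2 * u l - _ at this
    rwa [hul, mul_zero, mul_zero, sub_zero] at this
  have hv0 : ∫ x in 0..l, v x = 0 := by
    have := integral_deriv_mul_primitive hl (φ := fun x => (x : ℂ)) (φ' := fun _ => 1)
      (fun x => Complex.ofRealCLM.hasDerivAt) continuous_const hui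
    rw [hxu] at this
    change _ = (l : ℂ) * v l - 0 at this
    rw [hvl, mul_zero, sub_zero] at this
    simpa only [one_mul] using this
  have hfu : ofContinuous l u hu =ᵐ[volume.restrict (Ioo 0 l)] u := coeFn_ofContinuous hu
  have hfv : ofContinuous l v hv =ᵐ[volume.restrict (Ioo 0 l)] v := coeFn_ofContinuous hv
  have hH2 : IsH2ZeroWith (ofContinuous l v hv) g :=
    ⟨ofContinuous l u hu, hasWeakDeriv_primitive hl hui hfu hfv,
      hasWeakDeriv_primitive hl hw hgw hfu,
      ⟨v, hv.continuousOn, hfv, intervalIntegral.integral_same, hvl⟩,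
      ⟨u, hu.continuousOn, hfu, intervalIntegral.integral_same, hul⟩⟩
  refine ⟨-ofContinuous l v hv, ?_, fun n => ?_⟩
  · have := hH2.smul (-1)
    rwa [neg_one_smul, neg_one_smul] at this
  rw [inner_neg_right, inner_wave hl n hfv, inner_wave hl n hgw]
  -- Both zero modes vanish, so the artificial weight 1 is harmless.
  by_cases hn : n = 0
  · subst hn
    have h0 : phase l 0 = 0 := by simp [phase]
    have h1 : ∫ x in 0..l, w x = 0 := hul
    simp only [h0, neg_zero, zero_mul, Complex.exp_zero, one_mul, hv0, h1, mul_zero]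
  · have hd : ∀ x : ℝ, HasDerivAt (fun x : ℝ => Complex.exp (-phase l n * x))
        (-phase l n * Complex.exp (-phase l n * x)) x := by
      intro x
      have h1 := ((Complex.ofRealCLM.hasDerivAt (x := x)).const_mul (-phase l n)).cexp
      simp only [Complex.ofRealCLM_apply, Complex.ofReal_one, mul_one] at h1
      rwa [mul_comm] at h1
    have hc : Continuous fun x : ℝ => -phase l n * Complex.exp (-phase l n * x) := by fun_prop
    -- Two integrations by parts without boundary terms multiply the coefficient by `phase l n ^ 2`.
    have k1 := integral_deriv_mul_primitive hl hd hc hui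
    have k2 := integral_deriv_mul_primitive hl hd hc hw
    change _ = _ * v l - _ at k1
    change _ = _ * u l - _ at k2
    change ∫ x in 0..l, -phase l n * Complex.exp (-phase l n * x) * v x = _ at k1
    change ∫ x in 0..l, -phase l n * Complex.exp (-phase l n * x) * u x = _ at k2
    simp only [mul_assoc, intervalIntegral.integral_const_mul, hul, hvl, mul_zero, zero_sub]
      at k1 k2
    have hp := phase_ne_zero hl hn
    have hsq : phase l n ^ 2 * (periodicWeight l n : ℂ) = -1 := by
      have : (l : ℂ) ≠ 0 := by exact_mod_cast hl.ne'
      have : (n : ℂ) ≠ 0 := by exact_mod_cast hn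
      have : (Real.pi : ℂ) ≠ 0 := by exact_mod_cast Real.pi_ne_zero
      rw [phase, periodicWeight, if_neg hn]
      push_cast
      field_simp
      rw [Complex.I_sq]
    set A := ∫ x in 0..l, Complex.exp (-phase l n * x) * v x
    set B := ∫ x in 0..l, Complex.exp (-phase l n * x) * u x
    set D := ∫ x in 0..l, Complex.exp (-phase l n * x) * w x
    have hA : phase l n ^ 2 * A = D := by linear_combination (-phase l n) * k1 - k2
    apply mul_left_cancel₀ (pow_ne_zero 2 hp)
    linear_combination (-((√l)⁻¹ : ℝ)) * hA - ((√l)⁻¹ : ℝ) * D * hsq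

end Interval

end QuantumGraph

/-! ### Assembling the edges: the comparison operator on the graph and the mode count. -/

namespace QuantumGraph

theorem periodicWeight_pos {l : ℝ} (hl : 0 < l) (n : ℤ) : 0 < periodicWeight l n := by
  rw [periodicWeight]
  split_ifs with h
  · exact one_pos
  · have : (n : ℝ) ≠ 0 := by exact_mod_cast h
    have := Real.pi_pos
    positivity

/-- For `n ≠ 0` the condition is `2π|n| / l ≤ K`. The mode `n = 0` has weight 1 and is counted
because `1 ≤ K`. -/
theorem inv_periodicWeight_le_iff {l : ℝ} (hl : 0 < l) {K : ℝ} (hK : 1 ≤ K) (n : ℤ) :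
    (periodicWeight l n)⁻¹ ≤ K ^ 2 ↔
      n ∈ Finset.Icc (-⌊K * l / (2 * Real.pi)⌋) ⌊K * l / (2 * Real.pi)⌋ := by
  have hpi := Real.pi_pos
  have hK0 : 0 < K := by linarith
  rw [Finset.mem_Icc, ← abs_le, Int.le_floor, periodicWeight]
  split_ifs with h
  · subst h
    simp only [inv_one, abs_zero, Int.cast_zero]
    exact iff_of_true (one_le_pow₀ hK) (by positivity)
  · rw [← inv_pow, sq_le_sq, abs_of_pos hK0, inv_div, abs_div, abs_of_pos hl, abs_mul,
      abs_of_pos (by positivity : 0 < 2 * Real.pi), div_le_iff₀ hl, le_div_iff₀' (by positivity),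
      Int.cast_abs]

namespace MetricGraph

variable {V E : Type*} [Fintype V] [Fintype E] (Γ : MetricGraph V E)

open Classical in
theorem inner_single (e : E) (a : L2Interval (Γ.len e)) (f : Γ.L2) :
    inner ℂ (PiLp.single 2 e a : Γ.L2) f = inner ℂ a (f e) := by
  rw [PiLp.inner_apply, Finset.sum_eq_single e]
  · rw [PiLp.single_eq_same]
  · intro e' _ he
    rw [PiLp.single_eq_of_ne 2 he, inner_zero_left]
  · simp

open Classical in
/-- The eigenfunctions of the periodic Laplacians on the edges. -/
noncomputable def graphWave (p : Σ _ : E, ℤ) : Γ.L2 := PiLp.single 2 p.1 (wave (Γ.len p.1) p.2)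

theorem inner_graphWave (p : Σ _ : E, ℤ) (f : Γ.L2) :
    inner ℂ (Γ.graphWave p) f = inner ℂ (wave (Γ.len p.1) p.2) (f p.1) :=
  Γ.inner_single _ _ _

theorem orthonormal_graphWave : Orthonormal ℂ Γ.graphWave := by
  classical
  rw [orthonormal_iff_ite]
  rintro ⟨e, n⟩ ⟨e', n'⟩
  rw [inner_graphWave]
  by_cases h : e = e'
  · subst h
    rw [graphWave, PiLp.single_eq_same, orthonormal_iff_ite.mp (orthonormal_wave (Γ.len_pos e))]
    simp
  · rw [graphWave, PiLp.single_eq_of_ne 2 h, inner_zero_right, if_neg]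
    simp [h]

/-- The Hilbert basis of `L²(Γ)` consisting of exponentials on the edges. -/
noncomputable def waveBasis : HilbertBasis (Σ _ : E, ℤ) ℂ Γ.L2 :=
  HilbertBasis.mkOfOrthogonalEqBot Γ.orthonormal_graphWave (by
    rw [Submodule.eq_bot_iff]
    intro f hf
    refine PiLp.ext fun e => eq_zero_of_inner_wave (Γ.len_pos e) fun n => ?_
    rw [← Γ.inner_graphWave ⟨e, n⟩]
    exact (Submodule.mem_orthogonal _ _).mp hf _ (Submodule.subset_span ⟨_, rfl⟩))

theorem inner_waveBasis (p : Σ _ : E, ℤ) (f : Γ.L2) :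
    inner ℂ (Γ.waveBasis p) f = inner ℂ (wave (Γ.len p.1) p.2) (f p.1) := by
  rw [waveBasis, HilbertBasis.coe_mkOfOrthogonalEqBot, inner_graphWave]

theorem setOf_inv_periodicWeight_le {K : ℝ} (hK : 1 ≤ K) :
    {p : Σ _ : E, ℤ | (periodicWeight (Γ.len p.1) p.2)⁻¹ ≤ K ^ 2} =
      (Finset.univ : Finset E).sigma fun e =>
        Finset.Icc (-⌊K * Γ.len e / (2 * Real.pi)⌋) ⌊K * Γ.len e / (2 * Real.pi)⌋ := by
  ext p
  rw [mem_ofPred_eq, inv_periodicWeight_le_iff (Γ.len_pos _) hK]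
  simp

theorem tendsto_periodicWeight :
    Tendsto (fun p : Σ _ : E, ℤ => periodicWeight (Γ.len p.1) p.2) cofinite (nhds 0) := by
  rw [Metric.tendsto_nhds]
  intro ε hε
  rw [Filter.eventually_cofinite]
  -- Any `K ≥ 1` with `ε⁻¹ ≤ K²` would do.
  have hK : 1 ≤ 1 + 1 / ε := le_add_of_nonneg_right (by positivity)
  have hfin : {p : Σ _ : E, ℤ | (periodicWeight (Γ.len p.1) p.2)⁻¹ ≤ (1 + 1 / ε) ^ 2}.Finite := by
    rw [Γ.setOf_inv_periodicWeight_le hK]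
    exact Finset.finite_toSet _
  refine hfin.subset fun p hp => ?_
  have hpos := periodicWeight_pos (Γ.len_pos p.1) p.2
  simp only [mem_ofPred_eq, Real.dist_eq, sub_zero, abs_of_pos hpos, not_lt] at hp ⊢
  calc (periodicWeight (Γ.len p.1) p.2)⁻¹ ≤ ε⁻¹ := inv_anti₀ hε hp
    _ ≤ 1 + 1 / ε := by rw [one_div]; linarith
    _ ≤ (1 + 1 / ε) ^ 2 := le_self_pow₀ hK two_ne_zero

/-- The counting function of the periodic Laplacian, up to a bounded error. -/
theorem abs_ncard_sub_le {K : ℝ} (hK : 1 ≤ K) :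
    |({p : Σ _ : E, ℤ | (periodicWeight (Γ.len p.1) p.2)⁻¹ ≤ K ^ 2}.ncard : ℝ) -
      Γ.totalLength / Real.pi * K| ≤ Fintype.card E := by
  have hpi := Real.pi_pos
  rw [Γ.setOf_inv_periodicWeight_le hK, Set.ncard_coe_finset, Finset.card_sigma, totalLength,
    Finset.sum_div, Finset.sum_mul, Nat.cast_sum, ← Finset.sum_sub_distrib]
  refine (Finset.abs_sum_le_sum_abs _ _).trans ?_
  rw [← Finset.card_univ, ← nsmul_one, ← Finset.sum_const]
  refine Finset.sum_le_sum fun e _ => ?_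
  have hl := Γ.len_pos e
  set N := ⌊K * Γ.len e / (2 * Real.pi)⌋ with hN
  have hN0 : 0 ≤ N := Int.floor_nonneg.mpr (by positivity)
  -- With `t = K l / (2π)`, `2⌊t⌋ + 1` is within 1 of `2t = K l / π`: an error of at most 1 per
  -- edge.
  have hcard : ((Finset.Icc (-N) N).card : ℝ) = 2 * N + 1 := by
    rw [Int.card_Icc]
    have : (((N + 1 - -N).toNat : ℤ) : ℝ) = 2 * N + 1 := by
      rw [Int.toNat_of_nonneg (by omega)]
      push_cast
      ring
    exact_mod_cast this
  have h1 := Int.floor_le (K * Γ.len e / (2 * Real.pi))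
  have h2 := Int.lt_floor_add_one (K * Γ.len e / (2 * Real.pi))
  rw [← hN] at h1 h2
  have h3 : Γ.len e / Real.pi * K = 2 * (K * Γ.len e / (2 * Real.pi)) := by
    field_simp
  rw [hcard, h3, abs_le]
  constructor <;> linarith

open Classical in
/-- The functions on `Γ` that are polynomials of degree at most two on every edge. -/
noncomputable def quadratics : Submodule ℂ Γ.L2 :=
  Submodule.span ℂ (range fun p : E × Fin 3 =>
    (PiLp.single 2 p.1 (monomialL2 (Γ.len p.1) p.2) : Γ.L2))

instance : FiniteDimensional ℂ Γ.quadratics :=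
  FiniteDimensional.span_of_finite ℂ (Set.finite_range _)

/-- The edgewise solutions lie in the minimal domain, hence in the domain of every realisation; the
boundary conditions of `T` play no role. -/
theorem exists_isComparison {T : Γ.L2 →ₗ.[ℂ] Γ.L2} (hT : Γ.IsSelfAdjointLaplacian T) :
    ∃ G : Γ.L2 →L[ℂ] Γ.L2, IsComparison T Γ.waveBasis
      (fun p => periodicWeight (Γ.len p.1) p.2) G Γ.quadratics := by
  classical
  obtain ⟨C, hC⟩ : ∃ C : ℝ, ∀ p : Σ _ : E, ℤ, periodicWeight (Γ.len p.1) p.2 ≤ C := by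
    have hfin := Γ.tendsto_periodicWeight.eventually (gt_mem_nhds one_pos)
    rw [Filter.eventually_cofinite] at hfin
    obtain ⟨C, hC⟩ := (hfin.image fun p => periodicWeight (Γ.len p.1) p.2).bddAbove
    refine ⟨max 1 C, fun p => ?_⟩
    by_cases hp : periodicWeight (Γ.len p.1) p.2 < 1
    · exact hp.le.trans (le_max_left _ _)
    · exact (hC ⟨p, hp, rfl⟩).trans (le_max_right _ _)
  obtain ⟨G, hG, -⟩ := exists_diagonal Γ.waveBasis (ν := fun p => periodicWeight (Γ.len p.1) p.2)
    (C := max 0 C) (le_max_left _ _) (fun p => by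
      rw [abs_of_pos (periodicWeight_pos (Γ.len_pos _) _)]
      exact (hC p).trans (le_max_right _ _))
  refine ⟨G, hT.2, fun p => periodicWeight_pos (Γ.len_pos _) _, Γ.tendsto_periodicWeight, hG,
    inferInstance, fun g hg => ?_⟩
  have hge : ∀ e, ∀ k < 3, inner ℂ (monomialL2 (Γ.len e) k) (g e) = 0 := by
    intro e k hk
    rw [← Γ.inner_single e]
    exact (Submodule.mem_orthogonal _ _).mp hg _ (Submodule.subset_span ⟨(e, ⟨k, hk⟩), rfl⟩)
  choose f hf hfg using fun e => exists_isH2ZeroWith (Γ.len_pos e) (g e) (hge e)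
  -- `G g` and the edgewise solutions have the same Fourier coefficients.
  have hGf : G g = WithLp.toLp 2 f := by
    apply hilbertBasis_ext Γ.waveBasis
    intro p
    rw [hG, inner_waveBasis, inner_waveBasis]
    exact (hfg p.1 p.2).symm
  rw [hGf]
  apply LinearPMap.le_graph_of_le hT.1
  rw [graph_minimalLaplacian]
  exact hf

/-- Weyl's law with a bounded remainder. -/
theorem exists_abs_eigenvalueCount_sub_le {T : Γ.L2 →ₗ.[ℂ] Γ.L2}
    (hT : Γ.IsSelfAdjointLaplacian T) : ∃ C : ℝ, ∀ K : ℝ, 1 ≤ K →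
      |(eigenvalueCount T K : ℝ) - Γ.totalLength / Real.pi * K| ≤ C := by
  obtain ⟨G, hG⟩ := Γ.exists_isComparison hT
  refine ⟨Fintype.card E + Module.finrank ℂ Γ.quadratics, fun K hK => ?_⟩
  have h1 : (eigenvalueCount T K : ℝ) ≤ _ := Nat.cast_le.mpr (hG.eigenvalueCount_le K)
  have h2 : _ ≤ ((eigenvalueCount T K + Module.finrank ℂ Γ.quadratics : ℕ) : ℝ) :=
    Nat.cast_le.mpr (hG.le_eigenvalueCount K)
  have h3 := abs_le.mp (Γ.abs_ncard_sub_le hK)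
  push_cast at h1 h2
  rw [abs_le]
  constructor <;> linarith [h3.1, h3.2]

theorem totalLength_pos [Nonempty E] : 0 < Γ.totalLength :=
  Finset.sum_pos (fun e _ => Γ.len_pos e) Finset.univ_nonempty

end MetricGraph

end QuantumGraph

/-! ### The main theorem. -/

theorem proposition3p1 {V E : Type*} [Fintype V] [Fintype E] [Nonempty E]
    (Γ : QuantumGraph.MetricGraph V E) (T : Γ.L2 →ₗ.[ℂ] Γ.L2)
    (hT : Γ.IsSelfAdjointLaplacian T) :
    -- all eigenvalues are real
    (∀ μ : ℂ, QuantumGraph.IsEigenvalue T μ → μ.im = 0) ∧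
    -- every eigenvalue has finite multiplicity
    (∀ μ : ℂ, FiniteDimensional ℂ (QuantumGraph.eigenspace T μ)) ∧
    -- below any bound there are only finitely many eigenvalues
    (∀ R : ℝ, {μ : ℝ | QuantumGraph.IsEigenvalue T (μ : ℂ) ∧ μ ≤ R}.Finite) ∧
    -- there are infinitely many eigenvalues
    {μ : ℝ | QuantumGraph.IsEigenvalue T (μ : ℂ)}.Infinite ∧
    -- Weyl's law
    (fun K : ℝ => (QuantumGraph.eigenvalueCount T K : ℝ)) ~[atTop]
      (fun K : ℝ => Γ.totalLength / Real.pi * K) := by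
  obtain ⟨G, hG⟩ := Γ.exists_isComparison hT
  obtain ⟨C, hC⟩ := Γ.exists_abs_eigenvalueCount_sub_le hT
  have ha : 0 < Γ.totalLength / Real.pi := div_pos Γ.totalLength_pos Real.pi_pos
  refine ⟨fun μ hμ => ?_, hG.finiteDimensional_eigenspace, hG.finite_eigenvalues, fun hfin => ?_, ?_⟩
  · obtain ⟨f, hf, hf0⟩ := Submodule.exists_mem_ne_zero_of_ne_bot hμ
    exact QuantumGraph.eigenvalue_im hT.2 hf hf0
  -- Finitely many eigenvalues would bound the counting function, against its linear growth with
  -- positive slope.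
  · have hbound : ∀ K, QuantumGraph.eigenvalueCount T K ≤
        ∑ μ ∈ hfin.toFinset, Module.finrank ℂ (QuantumGraph.eigenspace T (μ : ℂ)) := by
      intro K
      rw [hG.eigenvalueCount_eq]
      refine Finset.sum_le_sum_of_subset fun μ hμ => ?_
      rw [Finite.mem_toFinset] at hμ ⊢
      exact hμ.1
    set B := ∑ μ ∈ hfin.toFinset, Module.finrank ℂ (QuantumGraph.eigenspace T (μ : ℂ))
    obtain ⟨K, hK, hKB⟩ := ((eventually_ge_atTop (1 : ℝ)).and
      ((tendsto_id.const_mul_atTop ha).eventually_gt_atTop (C + B))).exists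
    have h1 := (abs_le.mp (hC K hK)).1
    have h2 : (QuantumGraph.eigenvalueCount T K : ℝ) ≤ B := Nat.cast_le.mpr (hbound K)
    simp only [id] at hKB
    linarith
  · have h1 : (fun K : ℝ => (QuantumGraph.eigenvalueCount T K : ℝ) - Γ.totalLength / Real.pi * K)
        =O[atTop] fun _ => (1 : ℝ) := by
      refine IsBigO.of_bound C ?_
      filter_upwards [eventually_ge_atTop (1 : ℝ)] with K hK
      rw [norm_one, mul_one]
      exact hC K hK
    refine h1.trans_isLittleO ?_
    rw [isLittleO_const_mul_right_iff ha.ne']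
    exact isLittleO_const_id_atTop 1
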